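/- Let $R$ be an integral domain (for instance $\mathbb{Z}$ or a field). All homology is reduced simplicial homology with coefficients in $R$, with the conventions that the empty complex is the sphere of dimension $-1$ and has $\tilde H_{-1}=R$. A triangulation of a compact $4$-dimensional homology manifold $M$ (with possibly empty boundary) is a finite abstract simplicial complex such that the link of every simplex $\sigma$ has either the homology of the sphere of dimension $3-\dim\sigma$ or the homology of a ball (that is, vanishing reduced homology). Simplices of the second kind are the simplices of the boundary $\partial M$; all the others are called interior; $M$ is closed if $\partial M=\emptyset$. Denote by $f_i$ and $f_i(\partial M)$ the numbers of $i$-dimensional simplices of the triangulation and of its boundary, and let $\chi=f_0-f_1+f_2-f_3+f_4$ be the Euler characteristic of $M$. The triangulation is called rich if the link of every interior $2$-simplex is a simplicial loop of length at least $5$. Theorem. Every rich triangulation of a compact $4$-dimensional homology manifold $M$ with Euler characteristic $\chi$ satisfies $$2f_0\le 2\chi+f_1(\partial M).$$ In particular, if $M$ is closed, then $f_0\le\chi$. -/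

import Mathlib

set_option maxSynthPendingDepth 3

/-! Finite simplicial complexes are `PreAbstractSimplicialComplex`es: families of nonempty finite
sets of vertices, closed under nonempty subsets. So there are no loops and no two simplices on the
same set of vertices. A simplex of dimension `i` is a face with `i + 1` vertices; the empty simplex
is not listed among the faces. -/

noncomputable section

namespace PreAbstractSimplicialComplex

/-- The link of the face `s`: all nonempty `t` disjoint from `s` such that `s ∪ t` is a face. -/
def link {V : Type*} [DecidableEq V] (K : PreAbstractSimplicialComplex V) (s : Finset V) :
    PreAbstractSimplicialComplex V where
  faces := {t | t.Nonempty ∧ Disjoint s t ∧ s ∪ t ∈ K.faces}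
  isRelLowerSet_faces := by
    rintro t ⟨hne, hd, ht⟩
    refine ⟨hne, fun u hu hune => ⟨hune, Finset.disjoint_of_subset_right hu hd, ?_⟩⟩
    exact (K.isRelLowerSet_faces ht).2 (Finset.union_subset_union_right hu)
      (hune.mono Finset.subset_union_right)

/-- The simplicial boundary map on formal `R`-linear combinations of finite subsets of a linearly
ordered vertex set,
`∂ [v₀ < ⋯ < vᵢ] = ∑ⱼ (-1)ʲ [v₀, …, v̂ⱼ, …, vᵢ]`.
The boundary of a vertex is the empty simplex (this is the augmentation), and the boundary of the
empty simplex is zero. -/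
def boundaryMap (R : Type*) [CommRing R] (V : Type*) [LinearOrder V] :
    (Finset V →₀ R) →ₗ[R] (Finset V →₀ R) :=
  Finsupp.linearCombination R fun s : Finset V =>
    ∑ v ∈ s, Finsupp.single (s.erase v) ((-1 : R) ^ (s.filter (· < v)).card)

lemma boundaryMap_boundaryMap (R : Type*) [CommRing R] (V : Type*) [LinearOrder V]
    (c : Finset V →₀ R) : boundaryMap R V (boundaryMap R V c) = 0 := by
  have key : ∀ s : Finset V, boundaryMap R V (boundaryMap R V (Finsupp.single s 1)) = 0 := by
    intro s
    have h : boundaryMap R V (boundaryMap R V (Finsupp.single s 1)) =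
        ∑ p ∈ s.sigma (fun v => s.erase v),
          Finsupp.single ((s.erase p.1).erase p.2)
            ((-1 : R) ^ (s.filter (· < p.1)).card *
              (-1 : R) ^ ((s.erase p.1).filter (· < p.2)).card) := by
      rw [Finset.sum_sigma]
      simp [boundaryMap, Finsupp.linearCombination_single, map_sum, Finset.smul_sum]
    have cnt : ∀ a ∈ s, ∀ b ∈ s, a < b →
        ((s.erase a).filter (· < b)).card + 1 = (s.filter (· < b)).card ∧
        ((s.erase b).filter (· < a)).card = (s.filter (· < a)).card := by
      intro a ha b hb hab
      constructor
      · rw [Finset.filter_erase]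
        exact Finset.card_erase_add_one (by simp [ha, hab])
      · rw [Finset.filter_erase, Finset.erase_eq_of_notMem]
        simp [hab.le]
    rw [h]
    refine Finset.sum_involution (fun p _ => ⟨p.2, p.1⟩) ?_ ?_ ?_ ?_
    · rintro ⟨v, w⟩ hp
      simp only [Finset.mem_sigma, Finset.mem_erase] at hp
      obtain ⟨hv, hne, hw⟩ := hp
      rw [Finset.erase_right_comm, ← Finsupp.single_add]
      rcases lt_or_gt_of_ne hne with hlt | hlt
      · obtain ⟨h1, h2⟩ := cnt w hw v hv hlt
        simp only [← h1, h2, pow_succ]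
        simp only [Finsupp.single_eq_zero]
        ring
      · obtain ⟨h1, h2⟩ := cnt v hv w hw hlt
        simp only [← h1, h2, pow_succ]
        simp only [Finsupp.single_eq_zero]
        ring
    · rintro ⟨v, w⟩ hp _ heq
      simp only [Finset.mem_sigma, Finset.mem_erase] at hp
      simp only [Sigma.mk.injEq] at heq
      exact hp.2.1 heq.1
    · rintro ⟨v, w⟩ hp
      simp only [Finset.mem_sigma, Finset.mem_erase] at hp ⊢
      exact ⟨hp.2.2, hp.2.1.symm, hp.1⟩
    · rintro ⟨v, w⟩ hp
      rfl
  induction c using Finsupp.induction_linear with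
  | zero => simp
  | add f g hf hg => simp [hf, hg]
  | single s r =>
    have : Finsupp.single s r = r • Finsupp.single s (1 : R) := by simp
    rw [this, map_smul, map_smul, key, smul_zero]

/-- The augmented simplicial chains of `K` in degree `i`: combinations of the simplices of
dimension `i`, where the empty simplex has dimension `-1`. -/
def chains (R : Type*) [CommRing R] {V : Type*} (K : PreAbstractSimplicialComplex V) (i : ℤ) :
    Submodule R (Finset V →₀ R) :=
  Finsupp.supported R R {s | (s = ∅ ∨ s ∈ K.faces) ∧ (s.card : ℤ) = i + 1}

/-- The reduced simplicial cycles of `K` in degree `i`. -/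
def cycles (R : Type*) [CommRing R] {V : Type*} [LinearOrder V]
    (K : PreAbstractSimplicialComplex V) (i : ℤ) : Submodule R (Finset V →₀ R) :=
  K.chains R i ⊓ LinearMap.ker (boundaryMap R V)

/-- The reduced simplicial boundaries of `K` in degree `i`. -/
def boundaries (R : Type*) [CommRing R] {V : Type*} [LinearOrder V]
    (K : PreAbstractSimplicialComplex V) (i : ℤ) : Submodule R (Finset V →₀ R) :=
  (K.chains R (i + 1)).map (boundaryMap R V)

lemma boundaries_le_cycles (R : Type*) [CommRing R] {V : Type*} [LinearOrder V]
    (K : PreAbstractSimplicialComplex V) (i : ℤ) : K.boundaries R i ≤ K.cycles R i := by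
  rintro _ ⟨c, hc, rfl⟩
  refine ⟨?_, boundaryMap_boundaryMap R V c⟩
  rw [← Finsupp.sum_single c, Finsupp.sum, map_sum]
  refine Submodule.sum_mem _ fun s hs => ?_
  obtain ⟨hK, hcard⟩ := (Finsupp.mem_supported R c).1 hc hs
  simp only [boundaryMap, Finsupp.linearCombination_single]
  refine Submodule.smul_mem _ _ (Submodule.sum_mem _ fun v hv =>
    Finsupp.single_mem_supported R _ ⟨?_, ?_⟩)
  · rcases hK with rfl | hK
    · simp at hv
    · rcases (s.erase v).eq_empty_or_nonempty with h | h
      · exact Or.inl h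
      · exact Or.inr ((K.isRelLowerSet_faces hK).2 (Finset.erase_subset _ _) h)
  · have := Finset.card_erase_add_one hv
    omega

/-- Reduced simplicial homology of `K` in degree `i` with coefficients in `R`. The linear order of
the vertices only serves to orient the simplices. -/
abbrev ReducedHomology (R : Type*) [CommRing R] {V : Type*} [LinearOrder V]
    (K : PreAbstractSimplicialComplex V) (i : ℤ) : Type _ :=
  K.cycles R i ⧸ (K.boundaries R i).submoduleOf (K.cycles R i)

/-- `K` has the homology of a sphere of dimension `d`. (The sphere of dimension `-1` is empty.) -/
def HasSphereHomology (R : Type*) [CommRing R] {V : Type*} [LinearOrder V]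
    (K : PreAbstractSimplicialComplex V) (d : ℤ) : Prop :=
  Nonempty (K.ReducedHomology R d ≃ₗ[R] R) ∧
    ∀ i : ℤ, i ≠ d → Subsingleton (K.ReducedHomology R i)

/-- `K` has the homology of a ball. -/
def HasBallHomology (R : Type*) [CommRing R] {V : Type*} [LinearOrder V]
    (K : PreAbstractSimplicialComplex V) : Prop :=
  ∀ i : ℤ, Subsingleton (K.ReducedHomology R i)

/-- `K` is a triangulation of a homology `m`-manifold, possibly with boundary: the link of every
simplex `s` has the homology of a sphere of dimension `m - 1 - dim s = m - s.card` or of a ball. The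
link of a maximal simplex is empty, so that every maximal simplex has dimension exactly `m`. -/
def IsHomologyManifold (R : Type*) [CommRing R] {V : Type*} [LinearOrder V] (m : ℕ)
    (K : PreAbstractSimplicialComplex V) : Prop :=
  ∀ s ∈ K.faces, (K.link s).HasSphereHomology R ((m : ℤ) - s.card) ∨ (K.link s).HasBallHomology R

/-- The simplices of the boundary of a triangulated homology manifold: those whose link has the
homology of a ball. All other simplices are interior. -/
def boundaryFaces (R : Type*) [CommRing R] {V : Type*} [LinearOrder V]
    (K : PreAbstractSimplicialComplex V) : Set (Finset V) :=
  {s | s ∈ K.faces ∧ (K.link s).HasBallHomology R}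

/-- `L` is a simplicial loop of length `n`. -/
def IsLoop {V : Type*} [DecidableEq V] (L : PreAbstractSimplicialComplex V) (n : ℕ) : Prop :=
  3 ≤ n ∧ ∃ p : ZMod n → V, Function.Injective p ∧
    ∀ t : Finset V, t ∈ L.faces ↔ ∃ i : ZMod n, t = {p i} ∨ t = {p i, p (i + 1)}

/-- A triangulated homology `m`-manifold is rich if the links of all interior simplices of
dimension `m - 2` (those with `m - 1` vertices) are loops of length at least `5`. -/
def IsRich (R : Type*) [CommRing R] {V : Type*} [LinearOrder V] (m : ℕ)
    (K : PreAbstractSimplicialComplex V) : Prop :=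
  ∀ s ∈ K.faces, s.card + 1 = m → s ∉ K.boundaryFaces R → ∃ n : ℕ, 5 ≤ n ∧ (K.link s).IsLoop n

/-- The number of simplices of dimension `i`. -/
def faceCount {V : Type*} (K : PreAbstractSimplicialComplex V) (i : ℕ) : ℕ :=
  {s | s ∈ K.faces ∧ s.card = i + 1}.ncard

/-- The number of simplices of dimension `i` of the boundary. -/
def boundaryFaceCount (R : Type*) [CommRing R] {V : Type*} [LinearOrder V]
    (K : PreAbstractSimplicialComplex V) (i : ℕ) : ℕ :=
  {s | s ∈ K.boundaryFaces R ∧ s.card = i + 1}.ncard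

/-- The Euler characteristic of a finite complex: the alternating sum of the numbers of simplices,
a simplex `s` having dimension `s.card - 1`. -/
def eulerChar {V : Type*} (K : PreAbstractSimplicialComplex V) : ℤ :=
  ∑ᶠ s ∈ K.faces, (-1 : ℤ) ^ (s.card - 1)

end PreAbstractSimplicialComplex

end

/-!
The proof is a count of incidences between simplices; topology enters only through the
Euler–Poincaré formula for links. Every simplex of a homology `m`-manifold lies in one with `m + 1`
vertices (a maximal simplex has an empty link, whose homology sits in degree `-1`), and the reduced
Euler characteristic of the link of a simplex `s` is that of a sphere if `s` is interior, and zero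
if `s` is a boundary simplex (`sum_cofaceCount_of_isHomologyManifold`). Since `R` is a domain, ranks
are additive on short exact sequences, so no duality and no field of fractions is needed.

Let `m = 4`, write `f₀, …, f₄` for the face numbers, `b₁` and `b₂` for the numbers of boundary edges
and boundary triangles. Summing the local identities over all edges and over all triangles, and
counting incident pairs both ways (`sum_cofaceCount`), gives
`f₁ - 3 f₂ + 6 f₃ - 10 f₄ = b₁ - f₁` and `4 f₃ - 10 f₄ = b₂`.
Richness says that every interior triangle lies in at least five 4-simplices, so that
`5 (f₂ - b₂) ≤ 10 f₄`. By the two identities,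
`2 χ + b₁ - 2 f₀ = 2 f₄ - (f₂ - b₂) ≥ 0`.
-/

noncomputable section

namespace PreAbstractSimplicialComplex

open Finset Module

/-! ### The Euler–Poincaré formula over a domain -/

/-- Additivity of ranks, for modules of finite rank over a domain. Finite generation is not
assumed: for a submodule such as the cycles of a complex it is not automatic when `R` is not
Noetherian, whereas the rank is finite because that of the chains is. -/
lemma finrank_quotient_add_finrank_of_rank_lt {R : Type*} [CommRing R] [IsDomain R] {M : Type*}
    [AddCommGroup M] [Module R M] (h : Module.rank R M < Cardinal.aleph0) (N : Submodule R M) :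
    finrank R (M ⧸ N) + finrank R N = finrank R M := by
  have hsum := Submodule.rank_quotient_add_rank N
  have hq := (self_le_add_right (Module.rank R (M ⧸ N)) (Module.rank R N)).trans hsum.le
  have hN := (self_le_add_left (Module.rank R N) (Module.rank R (M ⧸ N))).trans hsum.le
  rw [finrank, finrank, finrank, ← hsum,
    Cardinal.toNat_add (hq.trans_lt h) (hN.trans_lt h)]

section EulerPoincare

variable (R : Type*) [CommRing R] {V : Type*}

/-- The number of simplices with `n` vertices, the empty simplex included. -/
def augFaceCount (L : PreAbstractSimplicialComplex V) (n : ℕ) : ℕ :=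
  {s | (s = ∅ ∨ s ∈ L.faces) ∧ s.card = n}.ncard

lemma finite_augFaces {L : PreAbstractSimplicialComplex V} (hL : L.faces.Finite) (n : ℕ) :
    {s | (s = ∅ ∨ s ∈ L.faces) ∧ s.card = n}.Finite :=
  (hL.insert ∅).subset fun _ hs => hs.1

lemma chains_eq (L : PreAbstractSimplicialComplex V) (n : ℕ) :
    L.chains R ((n : ℤ) - 1) =
      Finsupp.supported R R {s | (s = ∅ ∨ s ∈ L.faces) ∧ s.card = n} := by
  simp [chains]

lemma module_finite_chains {L : PreAbstractSimplicialComplex V} (hL : L.faces.Finite) (n : ℕ) :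
    Module.Finite R (L.chains R ((n : ℤ) - 1)) := by
  have := (finite_augFaces hL n).to_subtype
  rw [chains_eq]
  exact Module.Finite.equiv (Finsupp.supportedEquivFinsupp (M := R) (R := R)
    {s | (s = ∅ ∨ s ∈ L.faces) ∧ s.card = n}).symm

variable [IsDomain R]

lemma finrank_chains {L : PreAbstractSimplicialComplex V} (hL : L.faces.Finite) (n : ℕ) :
    finrank R (L.chains R ((n : ℤ) - 1)) = L.augFaceCount n := by
  have := (finite_augFaces hL n).fintype
  rw [chains_eq, (Finsupp.supportedEquivFinsupp _).finrank_eq, finrank_finsupp_self, augFaceCount,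
    ← Nat.card_coe_set_eq, Nat.card_eq_fintype_card]

variable [LinearOrder V]

lemma rank_cycles_lt {L : PreAbstractSimplicialComplex V} (hL : L.faces.Finite) (n : ℕ) :
    Module.rank R (L.cycles R ((n : ℤ) - 1)) < Cardinal.aleph0 := by
  have := module_finite_chains R hL n
  exact (Submodule.rank_mono inf_le_left).trans_lt (rank_lt_aleph0 R (L.chains R ((n : ℤ) - 1)))

lemma augFaceCount_succ {L : PreAbstractSimplicialComplex V} (hL : L.faces.Finite) (n : ℕ) :
    L.augFaceCount (n + 1) = finrank R (L.boundaries R ((n : ℤ) - 1)) +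
      finrank R (L.cycles R (((n + 1 : ℕ) : ℤ) - 1)) := by
  have := module_finite_chains R hL (n + 1)
  let f := (boundaryMap R V).domRestrict (L.chains R (((n + 1 : ℕ) : ℤ) - 1))
  have hrange : LinearMap.range f = L.boundaries R ((n : ℤ) - 1) := by
    rw [LinearMap.range_domRestrict, boundaries]
    congr 2
    push_cast
    ring
  have hker : finrank R (LinearMap.ker f) =
      finrank R (L.cycles R (((n + 1 : ℕ) : ℤ) - 1)) := by
    rw [cycles, ← Submodule.map_comap_subtype, Submodule.finrank_map_subtype_eq]
    rfl
  rw [← finrank_chains R hL, ← hker, ← hrange, ← f.quotKerEquivRange.finrank_eq]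
  exact (finrank_quotient_add_finrank_of_rank_lt (rank_lt_aleph0 R _) _).symm

lemma augFaceCount_zero {L : PreAbstractSimplicialComplex V} (hL : L.faces.Finite) :
    L.augFaceCount 0 = finrank R (L.cycles R (((0 : ℕ) : ℤ) - 1)) := by
  rw [← finrank_chains R hL, cycles, inf_of_le_left]
  intro c hc
  rw [chains_eq, Finsupp.mem_supported] at hc
  rw [LinearMap.mem_ker, boundaryMap, Finsupp.linearCombination_apply, Finsupp.sum]
  refine Finset.sum_eq_zero fun s hs => ?_
  simp [Finset.card_eq_zero.1 (hc hs).2]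

lemma finrank_cycles {L : PreAbstractSimplicialComplex V} (hL : L.faces.Finite) (n : ℕ) :
    finrank R (L.cycles R ((n : ℤ) - 1)) = finrank R (L.ReducedHomology R ((n : ℤ) - 1)) +
      finrank R (L.boundaries R ((n : ℤ) - 1)) := by
  rw [← (Submodule.submoduleOfEquivOfLe (L.boundaries_le_cycles R _)).finrank_eq]
  exact (finrank_quotient_add_finrank_of_rank_lt (rank_cycles_lt R hL n) _).symm

/-- The partial alternating sums of face numbers and of Betti numbers differ by the rank of the
boundaries in the top degree. -/
lemma sum_augFaceCount_range {L : PreAbstractSimplicialComplex V} (hL : L.faces.Finite) (N : ℕ) :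
    ∑ n ∈ range (N + 1), (-1 : ℤ) ^ n * L.augFaceCount n =
      ∑ n ∈ range (N + 1), (-1 : ℤ) ^ n * finrank R (L.ReducedHomology R ((n : ℤ) - 1)) +
        (-1 : ℤ) ^ N * finrank R (L.boundaries R ((N : ℤ) - 1)) := by
  induction N with
  | zero =>
    have h := augFaceCount_zero R hL
    rw [finrank_cycles R hL 0] at h
    simp [h]
  | succ N ih =>
    rw [sum_range_succ, ih, sum_range_succ _ (N + 1), augFaceCount_succ R hL,
      finrank_cycles R hL (N + 1)]
    push_cast
    ring

/-- The Euler–Poincaré formula for reduced homology. The index `n` counts vertices, so that it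
stands for the dimension `n - 1`. -/
theorem sum_augFaceCount {L : PreAbstractSimplicialComplex V} (hL : L.faces.Finite) {N : ℕ}
    (hN : ∀ s ∈ L.faces, s.card ≤ N) :
    ∑ n ∈ range (N + 1), (-1 : ℤ) ^ n * L.augFaceCount n =
      ∑ n ∈ range (N + 1), (-1 : ℤ) ^ n * finrank R (L.ReducedHomology R ((n : ℤ) - 1)) := by
  have h0 : L.augFaceCount (N + 1) = 0 := by
    rw [augFaceCount, Set.ncard_eq_zero (finite_augFaces hL _), Set.eq_empty_iff_forall_notMem]
    rintro s ⟨rfl | hs, hc⟩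
    · simp at hc
    · have := hN s hs
      omega
  have h1 := augFaceCount_succ R hL N
  rw [sum_augFaceCount_range R hL, (by omega : finrank R (L.boundaries R ((N : ℤ) - 1)) = 0)]
  simp

variable {R}

lemma HasBallHomology.sum_augFaceCount {L : PreAbstractSimplicialComplex V}
    (h : L.HasBallHomology R) (hL : L.faces.Finite) {N : ℕ} (hN : ∀ s ∈ L.faces, s.card ≤ N) :
    ∑ n ∈ range (N + 1), (-1 : ℤ) ^ n * L.augFaceCount n = 0 := by
  rw [PreAbstractSimplicialComplex.sum_augFaceCount R hL hN]
  refine sum_eq_zero fun n _ => ?_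
  have := h ((n : ℤ) - 1)
  rw [finrank_zero_of_subsingleton]
  simp

lemma HasSphereHomology.sum_augFaceCount {L : PreAbstractSimplicialComplex V} {N : ℕ}
    (h : L.HasSphereHomology R ((N : ℤ) - 1)) (hL : L.faces.Finite)
    (hN : ∀ s ∈ L.faces, s.card ≤ N) :
    ∑ n ∈ range (N + 1), (-1 : ℤ) ^ n * L.augFaceCount n = (-1) ^ N := by
  rw [PreAbstractSimplicialComplex.sum_augFaceCount R hL hN, sum_eq_single N]
  · obtain ⟨e⟩ := h.1
    rw [e.finrank_eq]
    simp
  · intro n _ hn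
    have := h.2 ((n : ℤ) - 1) (by omega)
    rw [finrank_zero_of_subsingleton]
    simp
  · simp

end EulerPoincare

/-! ### Face numbers -/

open scoped Classical in
lemma card_filter_mem_boundaryFaces {R : Type*} [CommRing R] {V : Type*} [LinearOrder V]
    {K : PreAbstractSimplicialComplex V} (hfin : K.faces.Finite) (i : ℕ) :
    #{s ∈ {s ∈ hfin.toFinset | #s = i + 1} | s ∈ K.boundaryFaces R} = K.boundaryFaceCount R i := by
  rw [boundaryFaceCount, ← Set.ncard_coe_finset]
  congr 1
  ext s
  simp only [coe_filter, mem_filter, Set.Finite.mem_toFinset, Set.mem_ofPred_eq]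
  exact ⟨fun h => ⟨h.2, h.1.2⟩, fun h => ⟨⟨h.1.1, h.2⟩, h.1⟩⟩

lemma card_filter_eq_faceCount {V : Type*} {K : PreAbstractSimplicialComplex V}
    (hfin : K.faces.Finite) (i : ℕ) : #{s ∈ hfin.toFinset | #s = i + 1} = K.faceCount i := by
  rw [faceCount, ← Set.ncard_coe_finset]
  simp

lemma eulerChar_eq_sum {V : Type*} {K : PreAbstractSimplicialComplex V} (hfin : K.faces.Finite)
    {N : ℕ} (hN : ∀ s ∈ K.faces, #s ≤ N) :
    K.eulerChar = ∑ i ∈ range N, (-1 : ℤ) ^ i * K.faceCount i := by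
  have hpos : ∀ s ∈ K.faces, 0 < #s := fun s hs => card_pos.2 (K.isRelLowerSet_faces hs).1
  rw [eulerChar, finsum_mem_eq_finite_toFinset_sum _ hfin,
    ← sum_fiberwise_of_maps_to (t := range N) (g := fun s => #s - 1)]
  · refine sum_congr rfl fun i _ => ?_
    rw [← card_filter_eq_faceCount hfin, mul_comm, ← nsmul_eq_mul,
      filter_congr (q := fun s => #s = i + 1)]
    · refine sum_eq_card_nsmul fun s hs => ?_
      rw [(mem_filter.1 hs).2, Nat.add_sub_cancel]
    · intro s hs
      have := hpos s (hfin.mem_toFinset.1 hs)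
      omega
  · intro s hs
    have h1 := hpos s (hfin.mem_toFinset.1 hs)
    have h2 := hN s (hfin.mem_toFinset.1 hs)
    rw [mem_range]
    omega

/-! ### Counting simplices through links -/

section Cofaces

variable {V : Type*} [LinearOrder V]

/-- The number of members of `F` that have `n` vertices and contain `s`. -/
def cofaceCount (F : Finset (Finset V)) (s : Finset V) (n : ℕ) : ℕ :=
  #{u ∈ F | s ⊆ u ∧ #u = n}

lemma finite_link {K : PreAbstractSimplicialComplex V} (hfin : K.faces.Finite) (s : Finset V) :
    (K.link s).faces.Finite := by
  refine (hfin.image (· \ s)).subset ?_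
  rintro t ⟨_, hd, ht⟩
  exact ⟨s ∪ t, ht, Finset.union_sdiff_cancel_left hd⟩

/-- Joining with `s` is a bijection from the simplices of the link of `s` to the simplices that
contain `s`. -/
lemma augFaceCount_link {K : PreAbstractSimplicialComplex V} (hfin : K.faces.Finite)
    {s : Finset V} (hs : s ∈ K.faces) (n : ℕ) :
    (K.link s).augFaceCount n = cofaceCount hfin.toFinset s (#s + n) := by
  have hmem : ∀ t, (t = ∅ ∨ t ∈ (K.link s).faces) ↔ Disjoint s t ∧ s ∪ t ∈ K.faces := by
    intro t
    rcases t.eq_empty_or_nonempty with rfl | ht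
    · simpa using hs
    · simp [link, ht, ht.ne_empty]
  rw [augFaceCount, cofaceCount, ← Set.ncard_coe_finset]
  refine Set.ncard_congr (fun t _ => s ∪ t) ?_ ?_ ?_
  · rintro t ⟨ht, rfl⟩
    obtain ⟨hd, hK⟩ := (hmem t).1 ht
    simp [hK, card_union_of_disjoint hd]
  · rintro t t' ⟨ht, _⟩ ⟨ht', _⟩ h
    rw [← Finset.union_sdiff_cancel_left ((hmem t).1 ht).1,
      ← Finset.union_sdiff_cancel_left ((hmem t').1 ht').1, h]
  · intro u hu
    simp only [coe_filter, Set.Finite.mem_toFinset, Set.mem_ofPred_eq] at hu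
    obtain ⟨hK, hsu, hc⟩ := hu
    refine ⟨u \ s, ⟨(hmem _).2 ⟨disjoint_sdiff, ?_⟩, ?_⟩, union_sdiff_of_subset hsu⟩
    · rwa [union_sdiff_of_subset hsu]
    · rw [card_sdiff_of_subset hsu]
      omega

/-- Counting the incident pairs of a simplex with `a` and a simplex with `n` vertices. -/
lemma sum_cofaceCount {K : PreAbstractSimplicialComplex V} (hfin : K.faces.Finite) {a : ℕ}
    (ha : 0 < a) (n : ℕ) :
    ∑ s ∈ hfin.toFinset with #s = a, cofaceCount hfin.toFinset s n =
      n.choose a * #{u ∈ hfin.toFinset | #u = n} := by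
  have h := sum_card_bipartiteAbove_eq_sum_card_bipartiteBelow (fun s u : Finset V => s ⊆ u)
    (s := {s ∈ hfin.toFinset | #s = a}) (t := {u ∈ hfin.toFinset | #u = n})
  have hl : ∀ s : Finset V, bipartiteAbove (fun s u : Finset V => s ⊆ u)
      {u ∈ hfin.toFinset | #u = n} s = {u ∈ hfin.toFinset | s ⊆ u ∧ #u = n} := by
    intro s
    ext u
    simp only [mem_bipartiteAbove, mem_filter]
    tauto
  simp only [cofaceCount]
  simp only [hl] at h
  rw [h, mul_comm, ← smul_eq_mul]
  refine sum_eq_card_nsmul fun u hu => ?_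
  rw [mem_filter, Set.Finite.mem_toFinset] at hu
  rw [← hu.2, ← card_powersetCard]
  congr 1
  ext s
  simp only [mem_bipartiteBelow, mem_filter, Set.Finite.mem_toFinset, mem_powersetCard]
  constructor
  · tauto
  · rintro ⟨hsu, hc⟩
    exact ⟨⟨(K.isRelLowerSet_faces hu.1).2 hsu (card_pos.1 (hc ▸ ha)), hc⟩, hsu⟩

/-- A loop of length `n` has `n` edges; only the lower bound is needed. -/
lemma IsLoop.le_augFaceCount_two {L : PreAbstractSimplicialComplex V} {n : ℕ} (h : L.IsLoop n)
    (hL : L.faces.Finite) : n ≤ L.augFaceCount 2 := by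
  obtain ⟨hn, p, hp, hface⟩ := h
  have : NeZero n := ⟨by omega⟩
  have : Fact (1 < n) := ⟨by omega⟩
  have h2 : (2 : ZMod n) ≠ 0 := by
    intro h0
    have := (ZMod.natCast_eq_zero_iff 2 n).1 (by exact_mod_cast h0)
    have := Nat.le_of_dvd (by norm_num) this
    omega
  have hne : ∀ i : ZMod n, p i ≠ p (i + 1) := fun i hi => by simpa using hp hi
  have hinj : Function.Injective fun i : ZMod n => ({p i, p (i + 1)} : Finset V) := by
    intro i j hij
    have hi : p i ∈ ({p j, p (j + 1)} : Finset V) := by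
      rw [← show ({p i, p (i + 1)} : Finset V) = {p j, p (j + 1)} from hij]; simp
    have hi' : p (i + 1) ∈ ({p j, p (j + 1)} : Finset V) := by
      rw [← show ({p i, p (i + 1)} : Finset V) = {p j, p (j + 1)} from hij]; simp
    simp only [mem_insert, mem_singleton, hp.eq_iff] at hi hi'
    rcases hi with hi | rfl
    · exact hi
    · rcases hi' with hi' | hi'
      · -- Here the edge is traversed in both directions, which needs a loop of length two.
        exact absurd (by linear_combination hi') h2
      · simp at hi'
  calc n = (Set.range fun i : ZMod n => ({p i, p (i + 1)} : Finset V)).ncard := by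
        rw [← Set.image_univ, Set.ncard_image_of_injective _ hinj, Set.ncard_univ, Nat.card_zmod]
    _ ≤ L.augFaceCount 2 := by
        refine Set.ncard_le_ncard ?_ (finite_augFaces hL 2)
        rintro _ ⟨i, rfl⟩
        exact ⟨.inr ((hface _).2 ⟨i, .inr rfl⟩), card_pair (hne i)⟩

/-- Since every interior simplex of codimension two lies in at least five simplices with two more
vertices, the incident pairs number at least five per interior simplex. -/
lemma IsRich.five_mul_le {R : Type*} [CommRing R] {i : ℕ}
    {K : PreAbstractSimplicialComplex V} (hrich : K.IsRich R (i + 2)) (hfin : K.faces.Finite) :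
    5 * ((K.faceCount i : ℤ) - K.boundaryFaceCount R i) ≤
      ((i + 3).choose (i + 1) * K.faceCount (i + 2) : ℕ) := by
  classical
  have hcard := card_filter_add_card_filter_not (s := {s ∈ hfin.toFinset | #s = i + 1})
    (fun s => s ∈ K.boundaryFaces R)
  rw [card_filter_mem_boundaryFaces, card_filter_eq_faceCount] at hcard
  rw [← card_filter_eq_faceCount hfin (i + 2), ← sum_cofaceCount hfin i.succ_pos, ← hcard]
  push_cast
  rw [add_sub_cancel_left]
  norm_cast
  refine le_trans ?_ (sum_le_sum_of_subset (filter_subset (fun s => s ∉ K.boundaryFaces R) _))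
  rw [mul_comm, ← smul_eq_mul]
  refine card_nsmul_le_sum _ _ _ fun s hs => ?_
  simp only [mem_filter, Set.Finite.mem_toFinset] at hs
  obtain ⟨⟨hsK, hc⟩, hb⟩ := hs
  obtain ⟨n, hn, hloop⟩ := hrich s hsK (by omega) hb
  have h := hloop.le_augFaceCount_two (finite_link hfin s)
  rw [augFaceCount_link hfin hsK, hc] at h
  exact hn.trans h

end Cofaces

/-! ### Local Euler characteristics of a homology manifold -/

section Manifold

variable {R : Type*} [CommRing R] [IsDomain R] {V : Type*} [LinearOrder V]

lemma not_subsingleton_reducedHomology_of_faces_eq_empty {L : PreAbstractSimplicialComplex V}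
    (hL : L.faces = ∅) : ¬ Subsingleton (L.ReducedHomology R (-1)) := by
  intro h
  have hN : ∀ s ∈ L.faces, s.card ≤ 0 := by simp [hL]
  have h1 := sum_augFaceCount R (by simp [hL]) hN
  have h2 : finrank R (L.ReducedHomology R (-1)) = 0 := finrank_zero_of_subsingleton
  have h3 : L.augFaceCount 0 = 1 := by
    rw [augFaceCount, Set.ncard_eq_one]
    exact ⟨∅, by ext s; simp [hL]⟩
  simp [h3, h2] at h1

/-- A maximal simplex has `m + 1` vertices since its link is empty, which is a sphere of dimension
`-1` and not a ball. -/
lemma IsHomologyManifold.card_le {m : ℕ} {K : PreAbstractSimplicialComplex V}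
    (hman : K.IsHomologyManifold R m) (hfin : K.faces.Finite) {s : Finset V} (hs : s ∈ K.faces) :
    #s ≤ m + 1 := by
  obtain ⟨u, hsu, hu⟩ := hfin.exists_le_maximal hs
  have hempty : (K.link u).faces = ∅ := by
    rw [Set.eq_empty_iff_forall_notMem]
    rintro t ⟨ht, hd, hut⟩
    have htu : t ⊆ u := subset_union_right.trans (hu.2 hut subset_union_left)
    exact ht.ne_empty (disjoint_self_iff_empty t |>.1 (hd.mono_left htu))
  have hnot := not_subsingleton_reducedHomology_of_faces_eq_empty (R := R) hempty
  have hcard := card_le_card hsu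
  rcases hman u hu.1 with h | h
  · by_contra hlt
    exact hnot (h.2 (-1) (by omega))
  · exact absurd (h (-1)) hnot

open scoped Classical in
/-- The reduced Euler characteristic of the link of `s`, up to sign, written as an alternating sum over the
simplices containing `s`: it vanishes if `s` lies in the boundary, and otherwise is that of a
sphere. -/
lemma sum_cofaceCount_of_isHomologyManifold {m k : ℕ} {K : PreAbstractSimplicialComplex V}
    (hman : K.IsHomologyManifold R m) (hfin : K.faces.Finite) {s : Finset V} (hs : s ∈ K.faces)
    (hk : #s + k = m + 1) :
    ∑ n ∈ range (k + 1), (-1 : ℤ) ^ n * cofaceCount hfin.toFinset s (#s + n) =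
      if s ∈ K.boundaryFaces R then 0 else (-1) ^ k := by
  have hN : ∀ t ∈ (K.link s).faces, #t ≤ k := by
    rintro t ⟨_, hd, ht⟩
    have := hman.card_le hfin ht
    rw [card_union_of_disjoint hd] at this
    omega
  simp only [← augFaceCount_link hfin hs]
  split_ifs with hb
  · exact hb.2.sum_augFaceCount (finite_link hfin s) hN
  · have hsph := (hman s hs).resolve_right fun h => hb ⟨hs, h⟩
    rw [show (m : ℤ) - #s = (k : ℤ) - 1 by omega] at hsph
    exact hsph.sum_augFaceCount (finite_link hfin s) hN

/-- The sum of the local identities over all simplices of dimension `i`: a Dehn–Sommerville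
relation. -/
lemma sum_choose_mul_faceCount {i k : ℕ} {K : PreAbstractSimplicialComplex V}
    (hman : K.IsHomologyManifold R (i + k)) (hfin : K.faces.Finite) :
    ∑ n ∈ range (k + 1), (-1 : ℤ) ^ n * ((i + 1 + n).choose (i + 1) * K.faceCount (i + n) : ℕ) =
      (-1) ^ k * (K.faceCount i - K.boundaryFaceCount R i) := by
  classical
  have h : ∑ s ∈ hfin.toFinset with #s = i + 1, ∑ n ∈ range (k + 1),
      (-1 : ℤ) ^ n * cofaceCount hfin.toFinset s (i + 1 + n) =
      ∑ s ∈ hfin.toFinset with #s = i + 1,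
        if s ∈ K.boundaryFaces R then 0 else (-1) ^ k := by
    refine sum_congr rfl fun s hs => ?_
    rw [mem_filter, Set.Finite.mem_toFinset] at hs
    rw [← sum_cofaceCount_of_isHomologyManifold hman hfin hs.1 (k := k) (by omega), hs.2]
  rw [sum_comm] at h
  have hcard := card_filter_add_card_filter_not (s := {s ∈ hfin.toFinset | #s = i + 1})
    (fun s => s ∈ K.boundaryFaces R)
  rw [card_filter_mem_boundaryFaces, card_filter_eq_faceCount] at hcard
  rw [sum_ite, sum_const_zero, zero_add, sum_const, nsmul_eq_mul, mul_comm] at h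
  rw [← hcard]
  push_cast
  rw [add_sub_cancel_left, ← h]
  refine sum_congr rfl fun n _ => ?_
  rw [← mul_sum, ← Nat.cast_sum, sum_cofaceCount hfin i.succ_pos, add_right_comm,
    card_filter_eq_faceCount]
  push_cast
  rfl

end Manifold

end PreAbstractSimplicialComplex

end

/-- A finite complex `K` triangulates a compact `4`-dimensional homology manifold (homology with
coefficients in an integral domain such as `ℤ` or a field); the manifold is closed if its boundary
has no simplices. -/
theorem theorem4p1 {R : Type*} [CommRing R] [IsDomain R] {V : Type*} [LinearOrder V]
    (K : PreAbstractSimplicialComplex V) (hfin : K.faces.Finite)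
    (hman : K.IsHomologyManifold R 4) (hrich : K.IsRich R 4) :
    2 * (K.faceCount 0 : ℤ) ≤ 2 * K.eulerChar + (K.boundaryFaceCount R 1 : ℤ) ∧
      (K.boundaryFaces R = ∅ → (K.faceCount 0 : ℤ) ≤ K.eulerChar) := by
  -- The relations for edges and for triangles.
  have h1 := PreAbstractSimplicialComplex.sum_choose_mul_faceCount (i := 1) (k := 3) hman hfin
  have h2 := PreAbstractSimplicialComplex.sum_choose_mul_faceCount (i := 2) (k := 2) hman hfin
  have h5 := PreAbstractSimplicialComplex.IsRich.five_mul_le (i := 2) hrich hfin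
  have hχ := PreAbstractSimplicialComplex.eulerChar_eq_sum hfin fun s hs => hman.card_le hfin hs
  simp only [Finset.sum_range_succ, Finset.sum_range_zero, Nat.choose] at h1 h2 hχ
  simp only [Nat.choose] at h5
  norm_num at h1 h2 h5 hχ
  have key : 2 * (K.faceCount 0 : ℤ) ≤ 2 * K.eulerChar + (K.boundaryFaceCount R 1 : ℤ) := by
    linarith
  refine ⟨key, fun hb => ?_⟩
  have h0 : K.boundaryFaceCount R 1 = 0 := by
    simp [PreAbstractSimplicialComplex.boundaryFaceCount, hb]
  rw [h0] at key
  push_cast at key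
  linarith
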